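/- Let $d_1,d_2,d_3\ge 1$ be integers, $D=d_1d_2d_3$ and $\mathcal H=\mathbb C^{d_1}\otimes\mathbb C^{d_2}\otimes\mathbb C^{d_3}$. For a unit vector $|\psi\rangle\in\mathcal H$ and a splitting $g|g'$ of the three factors put $\tau_{g|g'}(|\psi\rangle)=2\bigl(1-\operatorname{tr}\bigl[(\operatorname{tr}_g|\psi\rangle\langle\psi|)^2\bigr]\bigr)$, and let the one-tangle be $$\tau_1(|\psi\rangle)=\tfrac13\bigl[\tau_{12|3}(|\psi\rangle)+\tau_{13|2}(|\psi\rangle)+\tau_{23|1}(|\psi\rangle)\bigr].$$ For a unitary $U$ on $\mathcal H$, the entangling power $\epsilon_1(U)$ is the mean of $\tau_1\bigl(U(|a\rangle\otimes|b\rangle\otimes|c\rangle)\bigr)$, where $|a\rangle,|b\rangle,|c\rangle$ are independent random pure states of $\mathbb C^{d_1},\mathbb C^{d_2},\mathbb C^{d_3}$, each distributed according to the unitarily invariant probability measure. Put $$A=3-d_1-d_2-d_3-d_1d_2-d_1d_3-d_2d_3+3d_1d_2d_3 .$$ Then $\epsilon_1$ is integrable with respect to the normalised Haar measures on the unitary group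 $U(D)$ and on the real orthogonal group $O(D)\subset U(D)$ (matrices being taken in the product basis of $\mathcal H$), its mean over $U(D)$ is $$\langle\epsilon_1\rangle_{U(D)}=\frac{2A}{3(d_1d_2d_3+1)},$$ and, if $D>1$, its mean over $O(D)$ is $$\langle\epsilon_1\rangle_{O(D)}=\frac{2A\left(\left[\prod_{i=1}^3 d_i(d_i+1)\right]-8\right)}{3(d_1d_2d_3-1)(d_1d_2d_3+2)\left[\prod_{i=1}^3(d_i+1)\right]}.$$ -/

import Mathlib

open MeasureTheory Matrix

noncomputable section

namespace EntanglingPower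

section CompactGroups

variable {ι : Type*} [Fintype ι] [DecidableEq ι] {𝕜 : Type*} [RCLike 𝕜]

instance unitaryGroup.compactSpace : CompactSpace (unitaryGroup ι 𝕜) := by
  refine isCompact_iff_compactSpace.1 (?_ : IsCompact (unitaryGroup ι 𝕜 : Set (Matrix ι ι 𝕜)))
  have hK : IsCompact (Set.univ.pi fun _ : ι => Set.univ.pi fun _ : ι =>
      Metric.closedBall (0 : 𝕜) 1) :=
    isCompact_univ_pi fun _ => isCompact_univ_pi fun _ => isCompact_closedBall _ _
  have hC : IsClosed {A : Matrix ι ι 𝕜 | A * star A = 1} :=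
    isClosed_eq (by fun_prop) continuous_const
  refine IsCompact.of_isClosed_subset hK ?_ ?_
  · convert hC using 1
    ext A
    exact mem_unitaryGroup_iff
  · intro A hA i _ j _
    simpa using entry_norm_bound_of_unitary hA i j

/-- The unitary group carries its Borel `σ`-algebra. -/
instance unitaryGroup.measurableSpace : MeasurableSpace (unitaryGroup ι 𝕜) := borel _

instance unitaryGroup.borelSpace : BorelSpace (unitaryGroup ι 𝕜) := ⟨rfl⟩

end CompactGroups

/-- The Haar measure of a compact group, normalised to total mass one. -/
def haarProb (G : Type*) [Group G] [TopologicalSpace G] [IsTopologicalGroup G] [CompactSpace G]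
    [MeasurableSpace G] [BorelSpace G] : Measure G :=
  Measure.haarMeasure (⊤ : TopologicalSpace.PositiveCompacts G)

instance haarProb.isProbabilityMeasure (G : Type*) [Group G] [TopologicalSpace G]
    [IsTopologicalGroup G] [CompactSpace G] [MeasurableSpace G] [BorelSpace G] :
    IsProbabilityMeasure (haarProb G) :=
  ⟨Measure.haarMeasure_self (K₀ := (⊤ : TopologicalSpace.PositiveCompacts G))⟩

instance haarProb.isHaarMeasure (G : Type*) [Group G] [TopologicalSpace G]
    [IsTopologicalGroup G] [CompactSpace G] [MeasurableSpace G] [BorelSpace G] :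
    (haarProb G).IsHaarMeasure :=
  Measure.isHaarMeasure_haarMeasure _

/-- A real orthogonal matrix, regarded as a (complex) unitary matrix. -/
def orthogonalToUnitary {ι : Type*} [Fintype ι] [DecidableEq ι] (O : orthogonalGroup ι ℝ) :
    unitaryGroup ι ℂ :=
  ⟨(O : Matrix ι ι ℝ).map (fun x => (x : ℂ)), by
    have h : (O : Matrix ι ι ℝ) * star (O : Matrix ι ι ℝ) = 1 := mem_unitaryGroup_iff.1 O.2
    rw [mem_unitaryGroup_iff]
    have hs : star ((O : Matrix ι ι ℝ).map fun x => (x : ℂ))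
        = (star (O : Matrix ι ι ℝ)).map fun x => (x : ℂ) := by
      ext i j
      simp [Matrix.star_apply]
    have hm := Matrix.map_mul (L := (O : Matrix ι ι ℝ)) (M := star (O : Matrix ι ι ℝ))
      (f := Complex.ofRealHom)
    rw [h] at hm
    rw [hs]
    refine hm.symm.trans ?_
    simp⟩

/-- (Normalised vectors representing) pure states of the Hilbert space `ℂ^ι`. -/
abbrev PureState (ι : Type*) [Fintype ι] : Type _ :=
  Metric.sphere (0 : EuclideanSpace ℂ ι) 1

namespace PureState

variable {ι : Type*} [Fintype ι]

/-- The coefficients of a pure state in the computational basis. -/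
def coeff (ψ : PureState ι) (i : ι) : ℂ := (ψ : EuclideanSpace ℂ ι) i

theorem sum_normSq (ψ : PureState ι) : ∑ i, ‖ψ.coeff i‖ ^ 2 = 1 := by
  have h : ‖(ψ : EuclideanSpace ℂ ι)‖ = 1 := by simp
  rw [EuclideanSpace.norm_eq, Real.sqrt_eq_one] at h
  exact h

/-- A normalised family of coefficients is a pure state. -/
def mk (v : ι → ℂ) (hv : ∑ i, ‖v i‖ ^ 2 = 1) : PureState ι :=
  ⟨WithLp.toLp 2 v, by simp [EuclideanSpace.norm_eq, hv]⟩

/-- The computational basis state `|i⟩`. -/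
def ket [DecidableEq ι] (i : ι) : PureState ι :=
  mk (Pi.single i 1) (by
    rw [Finset.sum_eq_single i] <;> simp +contextual)

/-- The state `U|ψ⟩`. -/
def act [DecidableEq ι] (U : unitaryGroup ι ℂ) (ψ : PureState ι) : PureState ι :=
  mk ((U : Matrix ι ι ℂ) *ᵥ ψ.coeff) (by
    have hU : star (U : Matrix ι ι ℂ) * (U : Matrix ι ι ℂ) = 1 := mem_unitaryGroup_iff'.1 U.2
    have key : ∀ w : ι → ℂ, ((∑ i, ‖w i‖ ^ 2 : ℝ) : ℂ) = star w ⬝ᵥ w := by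
      intro w
      simp [dotProduct, Complex.conj_mul']
    have h : star ((U : Matrix ι ι ℂ) *ᵥ ψ.coeff) ⬝ᵥ ((U : Matrix ι ι ℂ) *ᵥ ψ.coeff)
        = star ψ.coeff ⬝ᵥ ψ.coeff := by
      rw [star_mulVec, dotProduct_mulVec, vecMul_vecMul, ← star_eq_conjTranspose, hU, vecMul_one]
    rw [← key, ← key, sum_normSq] at h
    exact_mod_cast h)

theorem act_act [DecidableEq ι] (U V : unitaryGroup ι ℂ) (ψ : PureState ι) :
    act U (act V ψ) = act (U * V) ψ := by
  apply Subtype.ext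
  change WithLp.toLp 2 ((U : Matrix ι ι ℂ) *ᵥ ((V : Matrix ι ι ℂ) *ᵥ ψ.coeff))
    = WithLp.toLp 2 (((U * V : unitaryGroup ι ℂ) : Matrix ι ι ℂ) *ᵥ ψ.coeff)
  rw [mulVec_mulVec]
  rfl

theorem sum_normSq_tensor {α β γ : Type*} [Fintype α] [Fintype β] [Fintype γ]
    (a : PureState α) (b : PureState β) (c : PureState γ) :
    ∑ i : α × β × γ, ‖a.coeff i.1 * (b.coeff i.2.1 * c.coeff i.2.2)‖ ^ 2 = 1 := by
  simp only [norm_mul, mul_pow, Fintype.sum_prod_type, ← Finset.mul_sum, sum_normSq, mul_one]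

/-- The product state `|a⟩ ⊗ |b⟩ ⊗ |c⟩`. -/
def tensor {α β γ : Type*} [Fintype α] [Fintype β] [Fintype γ]
    (a : PureState α) (b : PureState β) (c : PureState γ) : PureState (α × β × γ) :=
  mk (fun i => a.coeff i.1 * (b.coeff i.2.1 * c.coeff i.2.2)) (sum_normSq_tensor a b c)

/-- The density matrix `|ψ⟩⟨ψ|`. -/
def density (ψ : PureState ι) : Matrix ι ι ℂ := vecMulVec ψ.coeff (star ψ.coeff)

theorem continuous_coeff (i : ι) : Continuous fun ψ : PureState ι => ψ.coeff i := by
  unfold coeff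
  fun_prop

theorem continuous_mk {X : Type*} [TopologicalSpace X] {f : X → ι → ℂ}
    (hf : ∀ x, ∑ i, ‖f x i‖ ^ 2 = 1) (h : ∀ i, Continuous fun x => f x i) :
    Continuous fun x => mk (f x) (hf x) := by
  unfold mk
  have : Continuous f := continuous_pi h
  fun_prop

theorem continuous_tensor {α β γ : Type*} [Fintype α] [Fintype β] [Fintype γ] :
    Continuous fun p : PureState α × PureState β × PureState γ => tensor p.1 p.2.1 p.2.2 := by
  have h1 (i : α) : Continuous fun p : PureState α × PureState β × PureState γ => p.1.coeff i :=
    (continuous_coeff i).comp continuous_fst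
  have h2 (j : β) : Continuous fun p : PureState α × PureState β × PureState γ => p.2.1.coeff j :=
    (continuous_coeff j).comp (continuous_fst.comp continuous_snd)
  have h3 (k : γ) : Continuous fun p : PureState α × PureState β × PureState γ => p.2.2.coeff k :=
    (continuous_coeff k).comp (continuous_snd.comp continuous_snd)
  unfold tensor
  refine continuous_mk _ fun i => ?_
  exact (h1 i.1).mul ((h2 i.2.1).mul (h3 i.2.2))

theorem continuous_act [DecidableEq ι] :
    Continuous fun p : unitaryGroup ι ℂ × PureState ι => act p.1 p.2 := by
  refine continuous_mk _ fun i => ?_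
  simp only [mulVec, dotProduct]
  refine continuous_finsetSum _ fun j _ => ?_
  exact ((continuous_subtype_val.comp continuous_fst).matrix_elem i j).mul
    ((continuous_coeff j).comp continuous_snd)

end PureState

section Tripartite

variable {α β γ : Type*} [Fintype α] [Fintype β] [Fintype γ]

/-- The partial trace over the first and second factor. -/
def partialTrace12 (ρ : Matrix (α × β × γ) (α × β × γ) ℂ) : Matrix γ γ ℂ :=
  Matrix.of fun k k' => ∑ i, ∑ j, ρ (i, j, k) (i, j, k')

/-- The partial trace over the first and third factor. -/
def partialTrace13 (ρ : Matrix (α × β × γ) (α × β × γ) ℂ) : Matrix β β ℂ :=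
  Matrix.of fun j j' => ∑ i, ∑ k, ρ (i, j, k) (i, j', k)

/-- The partial trace over the second and third factor. -/
def partialTrace23 (ρ : Matrix (α × β × γ) (α × β × γ) ℂ) : Matrix α α ℂ :=
  Matrix.of fun i i' => ∑ j, ∑ k, ρ (i, j, k) (i', j, k)

/-- The generalised concurrence of a pure state for a bipartition of the system, as a function of
the reduced density matrix `σ`: `2 (1 - tr σ²)`. The trace is a real number, `σ` being
Hermitian. -/
def concurrence {κ : Type*} [Fintype κ] (σ : Matrix κ κ ℂ) : ℝ :=
  2 * (1 - (trace (σ * σ)).re)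

/-- The one-tangle of a tripartite pure state. -/
def oneTangle (ψ : PureState (α × β × γ)) : ℝ :=
  1 / 3 * (concurrence (partialTrace12 ψ.density) + concurrence (partialTrace13 ψ.density)
    + concurrence (partialTrace23 ψ.density))

theorem continuous_oneTangle : Continuous (oneTangle : PureState (α × β × γ) → ℝ) := by
  have h : ∀ i j : α × β × γ, Continuous fun ψ : PureState (α × β × γ) => ψ.density i j := by
    intro i j
    exact (PureState.continuous_coeff i).mul (PureState.continuous_coeff j).star
  unfold oneTangle concurrence trace
  simp only [Matrix.diag, Matrix.mul_apply, partialTrace12, partialTrace13, partialTrace23,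
    Matrix.of_apply]
  fun_prop

end Tripartite

/-- The unitarily invariant probability measure on the pure states of `ℂ^d`: the distribution of
`U|0⟩` for a Haar distributed unitary `U`. -/
def stateMeasure (d : ℕ) [NeZero d] : Measure (PureState (Fin d)) :=
  (haarProb (unitaryGroup (Fin d) ℂ)).map fun U => PureState.act U (PureState.ket 0)

theorem measurable_act_left {ι : Type*} [Fintype ι] [DecidableEq ι] (ψ : PureState ι) :
    Measurable fun U : unitaryGroup ι ℂ => PureState.act U ψ :=
  (PureState.continuous_act.comp (Continuous.prodMk_left ψ)).measurable

instance stateMeasure.isProbabilityMeasure (d : ℕ) [NeZero d] :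
    IsProbabilityMeasure (stateMeasure d) :=
  Measure.isProbabilityMeasure_map (measurable_act_left _).aemeasurable

theorem stateMeasure_map_act (d : ℕ) [NeZero d] (V : unitaryGroup (Fin d) ℂ) :
    (stateMeasure d).map (PureState.act V) = stateMeasure d := by
  have hV : Measurable (PureState.act V) :=
    (PureState.continuous_act.comp (Continuous.prodMk_right V)).measurable
  have hc : (PureState.act V ∘ fun U => PureState.act U (PureState.ket (0 : Fin d)))
      = (fun U => PureState.act U (PureState.ket (0 : Fin d))) ∘ fun U => V * U := by
    funext U
    exact PureState.act_act V U _
  have hm : Measurable fun U : unitaryGroup (Fin d) ℂ => V * U :=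
    (continuous_const_mul V).measurable
  rw [stateMeasure, Measure.map_map hV (measurable_act_left _), hc,
    ← Measure.map_map (measurable_act_left _) hm, map_mul_left_eq_self]

/-- The entangling power of a tripartite gate with respect to the one-tangle: the average of the
one-tangle of `U (|a⟩ ⊗ |b⟩ ⊗ |c⟩)` over independent random pure states `a`, `b`, `c` of the three
subsystems. -/
def entanglingPower {d₁ d₂ d₃ : ℕ} [NeZero d₁] [NeZero d₂] [NeZero d₃]
    (U : unitaryGroup (Fin d₁ × Fin d₂ × Fin d₃) ℂ) : ℝ :=
  ∫ p : PureState (Fin d₁) × PureState (Fin d₂) × PureState (Fin d₃),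
    oneTangle (PureState.act U (PureState.tensor p.1 p.2.1 p.2.2))
      ∂((stateMeasure d₁).prod ((stateMeasure d₂).prod (stateMeasure d₃)))

/-- The integrand in the definition of the entangling power is integrable. -/
theorem integrable_oneTangle {d₁ d₂ d₃ : ℕ} [NeZero d₁] [NeZero d₂] [NeZero d₃]
    (U : unitaryGroup (Fin d₁ × Fin d₂ × Fin d₃) ℂ) :
    Integrable (fun p : PureState (Fin d₁) × PureState (Fin d₂) × PureState (Fin d₃) =>
      oneTangle (PureState.act U (PureState.tensor p.1 p.2.1 p.2.2)))
      ((stateMeasure d₁).prod ((stateMeasure d₂).prod (stateMeasure d₃))) := by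
  have hc : Continuous fun p : PureState (Fin d₁) × PureState (Fin d₂) × PureState (Fin d₃) =>
      oneTangle (PureState.act U (PureState.tensor p.1 p.2.1 p.2.2)) :=
    continuous_oneTangle.comp ((PureState.continuous_act.comp (Continuous.prodMk_right U)).comp
      PureState.continuous_tensor)
  obtain ⟨C, hC⟩ := isCompact_univ.exists_bound_of_continuousOn hc.continuousOn
  exact Integrable.of_bound hc.aestronglyMeasurable C
    (Filter.Eventually.of_forall fun p => hC p (Set.mem_univ p))

end EntanglingPower

end

/-! The one-tangle is an affine function of three reduced purities, and these are of degree two in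
the coefficients and degree two in their conjugates. By Fubini
(`integrable_and_integral_entanglingPower`) the group may be averaged first, with the product state
φ fixed; only the fourth moments of the orbit of φ then matter.

Invariance under O(D) already forces E[ψᵢψⱼψ̄ₖψ̄ₗ] = α δᵢⱼδₖₗ + β(δᵢₖδⱼₗ + δᵢₗδⱼₖ)
(`OrthogonallyInvariant.exists_isotropicMoments`). Normalisation is one linear equation for α and β.
It turns the mean one-tangle into (2/3)·Dβ·A (`IsotropicMoments.integral_oneTangle`), so Dβ is all
that is needed.

Under U(D), phases give α = 0 and Dβ = 1/(D+1), whatever φ is. Under O(D) the second equation comes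
from s = |∑ψᵢ²|², which is constant on orbits; hence Dβ = (D - s)/((D-1)(D+2)). On product states s
factorises, and the unitary case in each factor gives it the mean ∏ 2/(dᵢ+1). -/

noncomputable section

namespace EntanglingPower

/-! ### Fourth moments and their contractions. -/

section Moments

variable {ι : Type*} [Fintype ι]

/-- The fourth moments of a measure on the pure states. -/
def moment (μ : Measure (PureState ι)) (i j k l : ι) : ℂ :=
  ∫ ψ, ψ.coeff i * ψ.coeff j * (star (ψ.coeff k) * star (ψ.coeff l)) ∂μ

theorem moment_swap_left (μ : Measure (PureState ι)) (i j k l : ι) :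
    moment μ i j k l = moment μ j i k l := by
  simp only [moment, mul_comm (PureState.coeff _ i)]

theorem moment_swap_right (μ : Measure (PureState ι)) (i j k l : ι) :
    moment μ i j k l = moment μ i j l k := by
  simp only [moment, mul_comm (star (PureState.coeff _ k))]

/-- The modulus squared of `∑ ψᵢ²`. -/
def realOverlap (ψ : PureState ι) : ℝ := ‖∑ i, ψ.coeff i ^ 2‖ ^ 2

theorem continuous_realOverlap : Continuous (realOverlap : PureState ι → ℝ) := by
  have h := PureState.continuous_coeff (ι := ι)
  unfold realOverlap
  fun_prop

theorem _root_.Continuous.integrable_of_compactSpace {X E : Type*} [TopologicalSpace X]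
    [CompactSpace X] [MeasurableSpace X] [OpensMeasurableSpace X] [NormedAddCommGroup E]
    [SecondCountableTopologyEither X E]
    {f : X → E} (hf : Continuous f) (μ : Measure X) [IsFiniteMeasure μ] : Integrable f μ := by
  obtain ⟨C, hC⟩ := isCompact_univ.exists_bound_of_continuousOn hf.continuousOn
  exact Integrable.of_bound hf.aestronglyMeasurable C
    (Filter.Eventually.of_forall fun p => hC p (Set.mem_univ p))

variable (μ : Measure (PureState ι)) [IsProbabilityMeasure μ]

theorem integrable_monomial (i j k l : ι) : Integrable (fun ψ : PureState ι =>
    ψ.coeff i * ψ.coeff j * (star (ψ.coeff k) * star (ψ.coeff l))) μ := by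
  have h := PureState.continuous_coeff (ι := ι)
  exact Continuous.integrable_of_compactSpace (by fun_prop) μ

theorem sum_coeff_mul_star (ψ : PureState ι) : ∑ i, ψ.coeff i * star (ψ.coeff i) = 1 := by
  have h := ψ.sum_normSq
  simp only [Complex.star_def, Complex.mul_conj']
  exact_mod_cast h

theorem sum_moment_eq_one : ∑ i, ∑ j, moment μ i j i j = 1 := by
  simp only [moment]
  have h (i j : ι) := integrable_monomial μ i j i j
  simp_rw [← integral_finsetSum _ fun j _ => h _ j]
  rw [← integral_finsetSum _ fun i _ => integrable_finsetSum _ fun j _ => h i j]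
  have : ∀ ψ : PureState ι, ∑ i, ∑ j,
      ψ.coeff i * ψ.coeff j * (star (ψ.coeff i) * star (ψ.coeff j)) = 1 := by
    intro ψ
    rw [← mul_one (1 : ℂ), ← sum_coeff_mul_star ψ, Finset.sum_mul_sum]
    exact Finset.sum_congr rfl fun i _ => Finset.sum_congr rfl fun j _ => by ring
  simp only [this, integral_const, probReal_univ, one_smul]

theorem integral_realOverlap :
    ((∫ ψ, realOverlap ψ ∂μ : ℝ) : ℂ) = ∑ i, ∑ j, moment μ i i j j := by
  simp only [moment]
  have h (i j : ι) := integrable_monomial μ i i j j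
  simp_rw [← integral_finsetSum _ fun j _ => h _ j]
  rw [← integral_finsetSum _ fun i _ => integrable_finsetSum _ fun j _ => h i j,
    ← integral_complex_ofReal]
  congr 1 with ψ
  have : ((realOverlap ψ : ℝ) : ℂ) = (∑ i, ψ.coeff i ^ 2) * star (∑ i, ψ.coeff i ^ 2) := by
    rw [realOverlap, Complex.star_def, Complex.mul_conj']
    push_cast
    rfl
  rw [this, star_sum, Finset.sum_mul_sum]
  exact Finset.sum_congr rfl fun i _ => Finset.sum_congr rfl fun j _ => by
    rw [star_pow]; ring

/-- The purity of the reduction to the first factor of a bipartition. -/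
def reducedPurity {κ ν : Type*} [Fintype κ] [Fintype ν] (e : κ × ν ≃ ι) (ψ : PureState ι) : ℂ :=
  ∑ k, ∑ k', ∑ n, ∑ n', ψ.coeff (e (k, n)) * ψ.coeff (e (k', n')) *
    (star (ψ.coeff (e (k', n))) * star (ψ.coeff (e (k, n'))))

theorem integrable_reducedPurity {κ ν : Type*} [Fintype κ] [Fintype ν] (e : κ × ν ≃ ι) :
    Integrable (reducedPurity e) μ := by
  have h := PureState.continuous_coeff (ι := ι)
  refine Continuous.integrable_of_compactSpace ?_ μ
  unfold reducedPurity
  fun_prop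

/-- Fourth moments of the isotropic form. -/
def IsotropicMoments [DecidableEq ι] (α β : ℂ) : Prop :=
  ∀ i j k l, moment μ i j k l = α * ((if i = j then 1 else 0) * (if k = l then 1 else 0))
    + β * ((if i = k then 1 else 0) * (if j = l then 1 else 0)
      + (if i = l then 1 else 0) * (if j = k then 1 else 0))

section Isotropic

variable [DecidableEq ι] {μ} {α β : ℂ}

/-- Contraction with δᵢₖδⱼₗ. Together with the contraction with δᵢⱼδₖₗ in the next lemma it gives
the linear system that determines α and β in dimension above one. -/
theorem IsotropicMoments.normalisation (h : IsotropicMoments μ α β) :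
    (Fintype.card ι : ℂ) * α + Fintype.card ι * (Fintype.card ι + 1) * β = 1 := by
  refine Eq.trans ?_ (sum_moment_eq_one μ)
  simp only [h _ _ _ _, Finset.sum_add_distrib, ← Finset.mul_sum]
  simp
  ring

theorem IsotropicMoments.integral_realOverlap (h : IsotropicMoments μ α β) :
    ((∫ ψ, realOverlap ψ ∂μ : ℝ) : ℂ)
      = (Fintype.card ι : ℂ) ^ 2 * α + 2 * Fintype.card ι * β := by
  rw [EntanglingPower.integral_realOverlap μ]
  simp only [h _ _ _ _, Finset.sum_add_distrib, ← Finset.mul_sum]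
  simp
  ring

/-- The α pairing forces k = k' and n = n'. The two β pairings force only k = k' and only n = n'
respectively, leaving one extra free index each. -/
theorem IsotropicMoments.integral_reducedPurity (h : IsotropicMoments μ α β)
    {κ ν : Type*} [Fintype κ] [Fintype ν] (e : κ × ν ≃ ι) :
    ∫ ψ, reducedPurity e ψ ∂μ = Fintype.card κ * Fintype.card ν *
      (α + β * (Fintype.card κ + Fintype.card ν)) := by
  classical
  have hi (k k' : κ) (n n' : ν) :=
    integrable_monomial μ (e (k, n)) (e (k', n')) (e (k', n)) (e (k, n'))
  have h1 : ∫ ψ, reducedPurity e ψ ∂μ = ∑ k, ∑ k', ∑ n, ∑ n',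
      moment μ (e (k, n)) (e (k', n')) (e (k', n)) (e (k, n')) := by
    simp only [reducedPurity, moment]
    simp_rw [← integral_finsetSum _ fun n' _ => hi _ _ _ n']
    simp_rw [← integral_finsetSum _ fun n _ => integrable_finsetSum _ fun n' _ => hi _ _ n n']
    simp_rw [← integral_finsetSum _ fun k' _ => integrable_finsetSum _ fun n _ =>
      integrable_finsetSum _ fun n' _ => hi _ k' n n']
    rw [← integral_finsetSum _ fun k _ => integrable_finsetSum _ fun k' _ =>
      integrable_finsetSum _ fun n _ => integrable_finsetSum _ fun n' _ => hi k k' n n']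
  have hs (p q : κ) (m n : ν) : (if p = q ∧ m = n then (1 : ℂ) else 0)
      = (if p = q then 1 else 0) * (if m = n then 1 else 0) := by
    split_ifs <;> simp_all
  rw [h1]
  simp only [h _ _ _ _, e.injective.eq_iff, Prod.mk.injEq, hs, Finset.sum_add_distrib,
    ← Finset.mul_sum]
  simp
  ring

end Isotropic

end Moments

/-! ### Orthogonal invariance forces isotropic moments. -/

section Invariance

variable {ι : Type*} [Fintype ι] [DecidableEq ι]

theorem coeff_act (U : unitaryGroup ι ℂ) (ψ : PureState ι) (i : ι) :
    (PureState.act U ψ).coeff i = ∑ j, (U : Matrix ι ι ℂ) i j * ψ.coeff j := rfl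

theorem coeff_orthogonalToUnitary (O : orthogonalGroup ι ℝ) (ψ : PureState ι) (i : ι) :
    (PureState.act (orthogonalToUnitary O) ψ).coeff i
      = ∑ j, ((O : Matrix ι ι ℝ) i j : ℂ) * ψ.coeff j := rfl

/-- Invariance under the real orthogonal group. -/
def OrthogonallyInvariant (μ : Measure (PureState ι)) : Prop :=
  ∀ O : orthogonalGroup ι ℝ, μ.map (PureState.act (orthogonalToUnitary O)) = μ

theorem measurable_act (U : unitaryGroup ι ℂ) : Measurable (PureState.act U) :=
  (PureState.continuous_act.comp (Continuous.prodMk_right U)).measurable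

theorem moment_map_act (μ : Measure (PureState ι)) {U : unitaryGroup ι ℂ}
    (h : μ.map (PureState.act U) = μ) (i j k l : ι) :
    moment μ i j k l = ∫ ψ, (PureState.act U ψ).coeff i * (PureState.act U ψ).coeff j *
      (star ((PureState.act U ψ).coeff k) * star ((PureState.act U ψ).coeff l)) ∂μ := by
  have hc := PureState.continuous_coeff (ι := ι)
  conv_lhs => rw [moment, ← h]
  rw [integral_map (measurable_act U).aemeasurable]
  exact Continuous.aestronglyMeasurable (by fun_prop)

/-- The permutation of coordinates. -/
def permOrthogonal (σ : Equiv.Perm ι) : orthogonalGroup ι ℝ :=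
  ⟨Matrix.of fun i j => if σ i = j then 1 else 0, by
    rw [mem_orthogonalGroup_iff]
    ext i j
    simp [Matrix.mul_apply, Matrix.one_apply]⟩

/-- The reflection `1 - t v vᵀ`. -/
def reflection (v : ι → ℝ) (t : ℝ) (h : t * (v ⬝ᵥ v) = 2) : orthogonalGroup ι ℝ :=
  ⟨1 - t • vecMulVec v v, by
    rw [mem_orthogonalGroup_iff]
    have : t • vecMulVec v v * (t • vecMulVec v v) = (2 * t) • vecMulVec v v := by
      rw [smul_mul_smul_comm, vecMulVec_mul_vecMulVec, ← h]
      ext i j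
      simp [vecMulVec_apply]
      ring
    simp only [transpose_sub, transpose_one, transpose_smul, transpose_vecMulVec]
    rw [sub_mul, mul_sub, mul_sub, this, one_mul, mul_one, one_mul, two_mul, add_smul]
    abel⟩

/-- The coordinate sign change. -/
def signFlip (p : ι) : orthogonalGroup ι ℝ := reflection (Pi.single p 1) 2 (by simp)

theorem coeff_permOrthogonal (σ : Equiv.Perm ι) (ψ : PureState ι) (i : ι) :
    (PureState.act (orthogonalToUnitary (permOrthogonal σ)) ψ).coeff i = ψ.coeff (σ i) := by
  simp [coeff_orthogonalToUnitary, permOrthogonal, apply_ite, ite_mul]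

theorem coeff_reflection (v : ι → ℝ) (t : ℝ) (h : t * (v ⬝ᵥ v) = 2) (ψ : PureState ι) (i : ι) :
    (PureState.act (orthogonalToUnitary (reflection v t h)) ψ).coeff i
      = ψ.coeff i - t * v i * ∑ j, v j * ψ.coeff j := by
  simp [coeff_orthogonalToUnitary, reflection, Matrix.one_apply, vecMulVec_apply, sub_mul,
    Finset.mul_sum, apply_ite, ite_mul, mul_assoc]

theorem coeff_signFlip (p : ι) (ψ : PureState ι) (i : ι) :
    (PureState.act (orthogonalToUnitary (signFlip p)) ψ).coeff i
      = (if i = p then -1 else 1) * ψ.coeff i := by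
  rw [signFlip, coeff_reflection]
  by_cases h : i = p
  · subst h
    simp [Pi.single_apply, apply_ite, ite_mul]
    ring
  · simp [h]

namespace OrthogonallyInvariant

variable {μ : Measure (PureState ι)}

theorem moment_perm (h : OrthogonallyInvariant μ) (σ : Equiv.Perm ι) (i j k l : ι) :
    moment μ (σ i) (σ j) (σ k) (σ l) = moment μ i j k l := by
  rw [moment_map_act μ (h (permOrthogonal σ)) i j k l]
  simp only [coeff_permOrthogonal, moment]

theorem moment_sign (h : OrthogonallyInvariant μ) (p i j k l : ι) :
    moment μ i j k l = (if i = p then -1 else 1) * (if j = p then -1 else 1) *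
      ((if k = p then -1 else 1) * (if l = p then -1 else 1)) * moment μ i j k l := by
  conv_lhs => rw [moment_map_act μ (h (signFlip p)) i j k l]
  simp only [coeff_signFlip, star_mul']
  rw [moment, ← integral_const_mul]
  congr 1 with ψ
  have (q : ι) : star (if q = p then (-1 : ℂ) else 1) = if q = p then -1 else 1 := by
    split_ifs <;> simp
  simp only [this]
  ring

/-- If p occurs an odd number of times, flipping the sign of coordinate p negates the moment. -/
theorem moment_odd (h : OrthogonallyInvariant μ) {p i j k l : ι} (hp : (if i = p then (-1 : ℂ) else 1) *
    (if j = p then -1 else 1) * ((if k = p then -1 else 1) * (if l = p then -1 else 1)) = -1) :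
    moment μ i j k l = 0 := by
  have := h.moment_sign p i j k l
  rw [hp] at this
  linear_combination this / 2

/-- Permutations and sign changes cannot relate these three values. A reflection that mixes
coordinates p and q does. -/
theorem moment_diag [IsProbabilityMeasure μ] (h : OrthogonallyInvariant μ) {p q : ι}
    (hpq : p ≠ q) : moment μ p p p p = moment μ p p q q + 2 * moment μ p q p q := by
  -- The reflection in v = (1, 2), with 2/|v|² = 2/5, has the rational row (3/5, -4/5).
  have hv : (2 / 5 : ℝ) * ((Pi.single p 1 + Pi.single q 2 : ι → ℝ) ⬝ᵥ
      (Pi.single p 1 + Pi.single q 2)) = 2 := by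
    simp [hpq, hpq.symm]
    norm_num
  set w : Fin 2 → ℂ := ![3 / 5, -4 / 5] with hw
  set e : Fin 2 → ι := ![p, q] with he
  have hc (ψ : PureState ι) : (PureState.act (orthogonalToUnitary (reflection _ _ hv)) ψ).coeff p
      = ∑ x, w x * ψ.coeff (e x) := by
    have hs : ∑ j, (((Pi.single p 1 + Pi.single q 2 : ι → ℝ) j : ℝ) : ℂ) * ψ.coeff j
        = ψ.coeff p + 2 * ψ.coeff q := by
      simp [add_mul, Finset.sum_add_distrib, Pi.single_apply, apply_ite Complex.ofReal, ite_mul]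
    rw [coeff_reflection, hs]
    simp [hpq, hw, he]
    ring
  have hws (x : Fin 2) : star (w x) = w x := by
    fin_cases x <;> simp [hw]
  have key : moment μ p p p p = ∑ x : Fin 2 × Fin 2 × Fin 2 × Fin 2,
      w x.1 * w x.2.1 * (w x.2.2.1 * w x.2.2.2) *
        moment μ (e x.1) (e x.2.1) (e x.2.2.1) (e x.2.2.2) := by
    rw [moment_map_act μ (h (reflection _ _ hv)) p p p p]
    simp only [moment]
    simp_rw [← integral_const_mul]
    rw [← integral_finsetSum _ fun x _ => (integrable_monomial μ _ _ _ _).const_mul _]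
    congr 1 with ψ
    rw [hc, star_sum]
    simp only [star_mul', hws, Fintype.sum_prod_type, Fin.sum_univ_two]
    ring
  have hsw := h.moment_perm (Equiv.swap p q)
  have h1 := hsw p p p p
  have h2 := hsw p p q q
  simp only [Equiv.swap_apply_left, Equiv.swap_apply_right] at h1 h2
  have o1 : moment μ p p p q = 0 := h.moment_odd (p := q) (by simp [hpq])
  have o3 : moment μ p q p p = 0 := h.moment_odd (p := q) (by simp [hpq])
  have o4 : moment μ q p p p = 0 := h.moment_odd (p := q) (by simp [hpq])
  have o6 : moment μ q q p q = 0 := h.moment_odd (p := p) (by simp [hpq.symm])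
  have o7 : moment μ q p q q = 0 := h.moment_odd (p := p) (by simp [hpq.symm])
  have o8 : moment μ p q q q = 0 := h.moment_odd (p := p) (by simp [hpq.symm])
  simp only [Fintype.sum_prod_type, Fin.sum_univ_two, hw, he, Matrix.cons_val_zero,
    Matrix.cons_val_one, o1, o3, o4, o6, o7, o8, h1, h2, moment_swap_left μ q p,
    moment_swap_right μ _ _ q p] at key
  -- The diagonal terms carry weight (81 + 256)/625 and each of the six paired terms 144/625; 1 -
  -- 337/625 = 288/625.
  linear_combination (625 / 288) * key

theorem exists_isotropicMoments [Nonempty ι] [IsProbabilityMeasure μ]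
    (h : OrthogonallyInvariant μ) : ∃ α β, IsotropicMoments μ α β := by
  obtain hs | hn := subsingleton_or_nontrivial ι
  · obtain ⟨p⟩ := ‹Nonempty ι›
    -- In dimension one only α + 2β is determined, so β = 0 is a choice.
    refine ⟨moment μ p p p p, 0, fun i j k l => ?_⟩
    simp [Subsingleton.elim i p, Subsingleton.elim j p, Subsingleton.elim k p,
      Subsingleton.elim l p]
  · obtain ⟨p, q, hpq⟩ := exists_pair_ne ι
    -- Permutations are doubly transitive, so one pair (p, q) fixes the values for all pairs.
    have hperm {r s : ι} (hrs : r ≠ s) : ∃ σ : Equiv.Perm ι, σ p = r ∧ σ q = s := by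
      refine ⟨Equiv.swap (Equiv.swap p r q) s * Equiv.swap p r, ?_, by simp⟩
      have : r ≠ Equiv.swap p r q := by
        intro h
        exact hpq ((Equiv.swap p r).injective ((Equiv.swap_apply_left p r).trans h))
      simp [Equiv.swap_apply_of_ne_of_ne this hrs]
    have hα {r s : ι} (hrs : r ≠ s) : moment μ r r s s = moment μ p p q q := by
      obtain ⟨σ, rfl, rfl⟩ := hperm hrs
      exact h.moment_perm σ _ _ _ _
    have hβ {r s : ι} (hrs : r ≠ s) : moment μ r s r s = moment μ p q p q := by
      obtain ⟨σ, rfl, rfl⟩ := hperm hrs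
      exact h.moment_perm σ _ _ _ _
    have hd (r : ι) : moment μ r r r r = moment μ p p q q + 2 * moment μ p q p q := by
      obtain ⟨s, hs⟩ := exists_ne r
      rw [h.moment_diag hs.symm, hα hs.symm, hβ hs.symm]
    have odd {i j k l : ι} (x : ι) := h.moment_odd (p := x) (i := i) (j := j) (k := k) (l := l)
    refine ⟨moment μ p p q q, moment μ p q p q, fun i j k l => ?_⟩
    -- In every unpaired pattern, `odd` receives an index that occurs exactly once.
    by_cases hij : i = j
    · subst hij
      by_cases hkl : k = l
      · subst hkl
        by_cases hik : i = k
        · subst hik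
          simp [hd]
          ring
        · simp [hik, hα hik]
      · by_cases hik : i = k
        · subst hik
          rw [odd l (by simp [hkl])]
          simp [hkl]
        · rw [odd k (by simp [hik, Ne.symm hkl])]
          simp [hkl, hik]
    · by_cases hik : i = k
      · subst hik
        by_cases hjl : j = l
        · subst hjl
          simp [hij, hβ hij]
        · rw [odd j (by simp [hij, Ne.symm hjl])]
          simp [hij, hjl, Ne.symm hij]
      · by_cases hil : i = l
        · subst hil
          by_cases hjk : j = k
          · subst hjk
            rw [moment_swap_right]
            simp [hij, hβ hij]
          · rw [odd j (by simp [hij, Ne.symm hjk])]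
            simp [hij, hik, hjk]
        · rw [odd i (by simp [Ne.symm hij, Ne.symm hik, Ne.symm hil])]
          simp [hij, hik, hil]

end OrthogonallyInvariant

end Invariance

/-! ### The one-tangle in terms of reduced purities. -/

section Tangle

variable {α β γ : Type*} [Fintype α] [Fintype β] [Fintype γ]

/-- The bipartition that isolates the third factor. -/
def isolateThird : γ × (α × β) ≃ α × β × γ where
  toFun x := (x.2.1, x.2.2, x.1)
  invFun x := (x.2.2, x.1, x.2.1)

/-- The bipartition that isolates the second factor. -/
def isolateSecond : β × (α × γ) ≃ α × β × γ where
  toFun x := (x.2.1, x.1, x.2.2)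
  invFun x := (x.2.1, x.1, x.2.2)

theorem trace_partialTrace12 (ψ : PureState (α × β × γ)) :
    trace (partialTrace12 ψ.density * partialTrace12 ψ.density)
      = reducedPurity isolateThird ψ := by
  simp only [trace, Matrix.diag, Matrix.mul_apply, partialTrace12, Matrix.of_apply,
    reducedPurity, Fintype.sum_prod_type, PureState.density, vecMulVec_apply, Finset.sum_mul,
    Finset.mul_sum, isolateThird, Equiv.coe_fn_mk, Pi.star_apply]
  rw [Finset.sum_comm]
  refine Finset.sum_congr rfl fun k _ => Finset.sum_congr rfl fun k' _ => ?_
  refine Finset.sum_congr rfl fun i _ => Finset.sum_congr rfl fun j _ => ?_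
  refine Finset.sum_congr rfl fun i' _ => Finset.sum_congr rfl fun j' _ => ?_
  ring

theorem trace_partialTrace13 (ψ : PureState (α × β × γ)) :
    trace (partialTrace13 ψ.density * partialTrace13 ψ.density)
      = reducedPurity isolateSecond ψ := by
  simp only [trace, Matrix.diag, Matrix.mul_apply, partialTrace13, Matrix.of_apply,
    reducedPurity, Fintype.sum_prod_type, PureState.density, vecMulVec_apply, Finset.sum_mul,
    Finset.mul_sum, isolateSecond, Equiv.coe_fn_mk, Pi.star_apply]
  rw [Finset.sum_comm]
  refine Finset.sum_congr rfl fun k _ => Finset.sum_congr rfl fun k' _ => ?_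
  refine Finset.sum_congr rfl fun i _ => Finset.sum_congr rfl fun j _ => ?_
  refine Finset.sum_congr rfl fun i' _ => Finset.sum_congr rfl fun j' _ => ?_
  ring

theorem trace_partialTrace23 (ψ : PureState (α × β × γ)) :
    trace (partialTrace23 ψ.density * partialTrace23 ψ.density)
      = reducedPurity (Equiv.refl _) ψ := by
  simp only [trace, Matrix.diag, Matrix.mul_apply, partialTrace23, Matrix.of_apply,
    reducedPurity, Fintype.sum_prod_type, PureState.density, vecMulVec_apply, Finset.sum_mul,
    Finset.mul_sum, Equiv.refl_apply, Pi.star_apply]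
  rw [Finset.sum_comm]
  refine Finset.sum_congr rfl fun k _ => Finset.sum_congr rfl fun k' _ => ?_
  refine Finset.sum_congr rfl fun i _ => Finset.sum_congr rfl fun j _ => ?_
  refine Finset.sum_congr rfl fun i' _ => Finset.sum_congr rfl fun j' _ => ?_
  ring

theorem oneTangle_eq (ψ : PureState (α × β × γ)) :
    oneTangle ψ = 2 / 3 * (3 - (reducedPurity isolateThird ψ + reducedPurity isolateSecond ψ
      + reducedPurity (Equiv.refl _) ψ).re) := by
  simp only [oneTangle, concurrence, trace_partialTrace12, trace_partialTrace13,
    trace_partialTrace23, Complex.add_re]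
  ring

theorem integral_oneTangle (μ : Measure (PureState (α × β × γ))) [IsProbabilityMeasure μ] :
    ∫ ψ, oneTangle ψ ∂μ = 2 / 3 * (3 - (∫ ψ, reducedPurity isolateThird ψ ∂μ
      + ∫ ψ, reducedPurity isolateSecond ψ ∂μ
      + ∫ ψ, reducedPurity (Equiv.refl (α × β × γ)) ψ ∂μ).re) := by
  have h3 := integrable_reducedPurity (μ := μ) isolateThird
  have h2 := integrable_reducedPurity (μ := μ) isolateSecond
  have h1 := integrable_reducedPurity (μ := μ) (Equiv.refl _)
  have hre := integral_re ((h3.add h2).add h1)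
  simp only [RCLike.re_eq_complex_re, Pi.add_apply] at hre
  have hint := ((h3.add h2).add h1).re
  simp only [RCLike.re_eq_complex_re, Pi.add_apply] at hint
  simp only [oneTangle_eq]
  have hadd : ∫ ψ, reducedPurity isolateThird ψ + reducedPurity isolateSecond ψ
      + reducedPurity (Equiv.refl (α × β × γ)) ψ ∂μ = ∫ ψ, reducedPurity isolateThird ψ ∂μ
      + ∫ ψ, reducedPurity isolateSecond ψ ∂μ
      + ∫ ψ, reducedPurity (Equiv.refl (α × β × γ)) ψ ∂μ := by
    rw [← integral_add h3 h2]
    exact integral_add (h3.add h2) h1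
  rw [integral_const_mul, integral_sub (integrable_const _) hint, hre, hadd]
  simp only [integral_const, probReal_univ, one_smul]

variable [DecidableEq α] [DecidableEq β] [DecidableEq γ]

/-- The mean one-tangle for isotropic moments. -/
theorem IsotropicMoments.integral_oneTangle {μ : Measure (PureState (α × β × γ))}
    [IsProbabilityMeasure μ] {x y : ℂ} (h : IsotropicMoments μ x y) {b : ℝ}
    (hb : (Fintype.card (α × β × γ) : ℂ) * y = b) :
    ∫ ψ, oneTangle ψ ∂μ = 2 / 3 * b * (3 * (Fintype.card α * Fintype.card β * Fintype.card γ + 1)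
      - (Fintype.card α + Fintype.card β + Fintype.card γ + Fintype.card α * Fintype.card β
      + Fintype.card α * Fintype.card γ + Fintype.card β * Fintype.card γ)) := by
  have hn := h.normalisation
  rw [EntanglingPower.integral_oneTangle, h.integral_reducedPurity, h.integral_reducedPurity,
    h.integral_reducedPurity]
  simp only [Fintype.card_prod, Nat.cast_mul] at hn hb ⊢
  set p : ℝ := (Fintype.card α : ℝ) with hp
  set q : ℝ := (Fintype.card β : ℝ) with hq
  set r : ℝ := (Fintype.card γ : ℝ) with hr
  rw [show (Fintype.card α : ℂ) = (p : ℂ) by simp [hp],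
    show (Fintype.card β : ℂ) = (q : ℂ) by simp [hq],
    show (Fintype.card γ : ℂ) = (r : ℂ) by simp [hr]] at *
  -- All three bipartitions contribute the same term pqr·x, which normalisation eliminates; what
  -- remains is linear in b.
  have key : (r : ℂ) * (p * q) * (x + y * (r + p * q)) + q * (p * r) * (x + y * (q + p * r))
      + p * (q * r) * (x + y * (p + q * r))
      = ((3 - b * (3 * (p * q * r + 1) - (p + q + r + p * q + p * r + q * r)) : ℝ) : ℂ) := by
    push_cast
    linear_combination 3 * hn - (3 * ((p : ℂ) * q * r + 1)
      - (p + q + r + p * q + p * r + q * r)) * hb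
  rw [key, Complex.ofReal_re]
  ring

end Tangle

/-! ### Unitary invariance, the conserved overlap, and orbits of states. -/

section States

variable {ι : Type*} [Fintype ι] [DecidableEq ι]

theorem orthogonalToUnitary_mul (O P : orthogonalGroup ι ℝ) :
    orthogonalToUnitary (O * P) = orthogonalToUnitary O * orthogonalToUnitary P :=
  Subtype.ext (Matrix.map_mul (f := Complex.ofRealHom))

theorem continuous_orthogonalToUnitary :
    Continuous (orthogonalToUnitary : orthogonalGroup ι ℝ → unitaryGroup ι ℂ) := by
  refine Continuous.subtype_mk ?_ _
  exact continuous_subtype_val.matrix_map Complex.continuous_ofReal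

/-- Invariance under the unitary group. -/
def UnitarilyInvariant (μ : Measure (PureState ι)) : Prop :=
  ∀ U : unitaryGroup ι ℂ, μ.map (PureState.act U) = μ

theorem UnitarilyInvariant.orthogonallyInvariant {μ : Measure (PureState ι)}
    (h : UnitarilyInvariant μ) : OrthogonallyInvariant μ :=
  fun O => h (orthogonalToUnitary O)

/-- The diagonal unitary with the phase `i` at one coordinate. -/
def phaseShift (p : ι) : unitaryGroup ι ℂ :=
  ⟨diagonal fun i => if i = p then Complex.I else 1, by
    rw [mem_unitaryGroup_iff, star_eq_conjTranspose, diagonal_conjTranspose, diagonal_mul_diagonal,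
      ← diagonal_one]
    congr 1 with i
    by_cases h : i = p <;> simp [h]⟩

theorem coeff_phaseShift (p : ι) (ψ : PureState ι) (i : ι) :
    (PureState.act (phaseShift p) ψ).coeff i = (if i = p then Complex.I else 1) * ψ.coeff i := by
  simp [coeff_act, phaseShift, diagonal_apply, ite_mul]

/-- The phase i at p multiplies ψₚ² by -1 and leaves ψ_q alone. -/
theorem UnitarilyInvariant.moment_eq_zero {μ : Measure (PureState ι)} (h : UnitarilyInvariant μ)
    {p q : ι} (hpq : p ≠ q) : moment μ p p q q = 0 := by
  have := moment_map_act μ (h (phaseShift p)) p p q q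
  have hI (ψ : PureState ι) : Complex.I * ψ.coeff p * (Complex.I * ψ.coeff p) *
      (star (ψ.coeff q) * star (ψ.coeff q))
      = -1 * (ψ.coeff p * ψ.coeff p * (star (ψ.coeff q) * star (ψ.coeff q))) := by
    linear_combination ψ.coeff p * ψ.coeff p * (star (ψ.coeff q) * star (ψ.coeff q)) *
      Complex.I_mul_I
  simp only [coeff_phaseShift, hpq.symm, if_true, if_false, one_mul, hI, integral_const_mul] at this
  rw [← moment] at this
  linear_combination this / 2

theorem UnitarilyInvariant.exists_isotropicMoments [Nonempty ι] {μ : Measure (PureState ι)}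
    [IsProbabilityMeasure μ] (h : UnitarilyInvariant μ) : ∃ y, IsotropicMoments μ 0 y := by
  obtain ⟨x, y, hxy⟩ := h.orthogonallyInvariant.exists_isotropicMoments
  obtain hsub | hnt := subsingleton_or_nontrivial ι
  -- In dimension one the single moment is x + 2y, so x is absorbed into y.
  · refine ⟨y + x / 2, fun i j k l => ?_⟩
    rw [hxy i j k l]
    simp only [Subsingleton.elim j i, Subsingleton.elim k i, Subsingleton.elim l i, if_true]
    ring
  · obtain ⟨p, q, hpq⟩ := exists_pair_ne ι
    have hx : x = 0 := by
      have := hxy p p q q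
      rw [h.moment_eq_zero hpq] at this
      simpa [hpq] using this.symm
    exact ⟨y, hx ▸ hxy⟩

theorem IsotropicMoments.card_mul_of_left_eq_zero {μ : Measure (PureState ι)}
    [IsProbabilityMeasure μ] {y : ℂ} (h : IsotropicMoments μ 0 y) :
    (Fintype.card ι : ℂ) * y = ((1 / (Fintype.card ι + 1) : ℝ) : ℂ) := by
  have hc : (Fintype.card ι : ℂ) + 1 ≠ 0 := Nat.cast_add_one_ne_zero _
  push_cast
  rw [eq_div_iff hc]
  linear_combination h.normalisation

theorem UnitarilyInvariant.integral_realOverlap [Nonempty ι] {μ : Measure (PureState ι)}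
    [IsProbabilityMeasure μ] (h : UnitarilyInvariant μ) :
    ∫ ψ, realOverlap ψ ∂μ = 2 / (Fintype.card ι + 1) := by
  obtain ⟨y, hy⟩ := h.exists_isotropicMoments
  rw [← Complex.ofReal_inj, hy.integral_realOverlap, mul_assoc, hy.card_mul_of_left_eq_zero]
  push_cast
  ring

/-- D times the normalisation minus the overlap equation eliminates α and leaves Dβ(D² + D - 2),
where D² + D - 2 = (D-1)(D+2). Dimension one is excluded because this factor vanishes there. -/
theorem IsotropicMoments.card_mul_eq [Nontrivial ι] {μ : Measure (PureState ι)}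
    [IsProbabilityMeasure μ] {x y : ℂ} (hxy : IsotropicMoments μ x y) :
    (Fintype.card ι : ℂ) * y = (((Fintype.card ι - ∫ ψ, realOverlap ψ ∂μ) /
      ((Fintype.card ι - 1) * (Fintype.card ι + 2)) : ℝ) : ℂ) := by
  have hn := hxy.normalisation
  have hs := hxy.integral_realOverlap
  have h1 : (Fintype.card ι : ℂ) - 1 ≠ 0 := by
    rw [sub_ne_zero]
    exact_mod_cast Fintype.one_lt_card.ne'
  have h2 : (Fintype.card ι : ℂ) + 2 ≠ 0 := by exact_mod_cast Nat.succ_ne_zero (Fintype.card ι + 1)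
  push_cast
  rw [eq_div_iff (mul_ne_zero h1 h2), hs]
  linear_combination (Fintype.card ι : ℂ) * hn

/-- The bilinear form ψᵀψ, without conjugation, is preserved because OᵀO = 1. This is why the
orthogonal average still depends on the initial state. -/
theorem realOverlap_orthogonal (O : orthogonalGroup ι ℝ) (ψ : PureState ι) :
    realOverlap (PureState.act (orthogonalToUnitary O) ψ) = realOverlap ψ := by
  have hO : ((orthogonalToUnitary O : unitaryGroup ι ℂ) : Matrix ι ι ℂ)ᵀ *
      (orthogonalToUnitary O : unitaryGroup ι ℂ) = 1 := by
    have h := congrArg (fun M : Matrix ι ι ℝ => M.map Complex.ofRealHom)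
      ((mem_orthogonalGroup_iff' ι ℝ).1 O.2)
    simp only [Matrix.map_mul] at h
    rw [Matrix.map_one _ (map_zero _) (map_one _)] at h
    exact h
  have key (w : ι → ℂ) : ∑ i, w i ^ 2 = w ⬝ᵥ w := by
    simp [dotProduct, sq]
  have : (PureState.act (orthogonalToUnitary O) ψ).coeff
      = ((orthogonalToUnitary O : unitaryGroup ι ℂ) : Matrix ι ι ℂ) *ᵥ ψ.coeff := rfl
  rw [realOverlap, realOverlap, key, key, this, dotProduct_mulVec, ← mulVec_transpose,
    mulVec_mulVec, hO, one_mulVec]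

/-- The distribution of `U|φ⟩` for a Haar distributed unitary `U`. -/
def unitaryOrbit (φ : PureState ι) : Measure (PureState ι) :=
  (haarProb (unitaryGroup ι ℂ)).map fun U => PureState.act U φ

/-- The distribution of `O|φ⟩` for a Haar distributed orthogonal matrix `O`. -/
def orthogonalOrbit (φ : PureState ι) : Measure (PureState ι) :=
  (haarProb (orthogonalGroup ι ℝ)).map fun O => PureState.act (orthogonalToUnitary O) φ

theorem continuous_act_orthogonal :
    Continuous fun p : orthogonalGroup ι ℝ × PureState ι =>
      PureState.act (orthogonalToUnitary p.1) p.2 :=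
  PureState.continuous_act.comp
    ((continuous_orthogonalToUnitary.comp continuous_fst).prodMk continuous_snd)

theorem measurable_act_orthogonal (φ : PureState ι) :
    Measurable fun O : orthogonalGroup ι ℝ => PureState.act (orthogonalToUnitary O) φ :=
  (continuous_act_orthogonal.comp (Continuous.prodMk_left φ)).measurable

instance unitaryOrbit.isProbabilityMeasure (φ : PureState ι) :
    IsProbabilityMeasure (unitaryOrbit φ) :=
  Measure.isProbabilityMeasure_map (measurable_act_left _).aemeasurable

instance orthogonalOrbit.isProbabilityMeasure (φ : PureState ι) :
    IsProbabilityMeasure (orthogonalOrbit φ) :=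
  Measure.isProbabilityMeasure_map (measurable_act_orthogonal _).aemeasurable

theorem unitarilyInvariant_unitaryOrbit (φ : PureState ι) :
    UnitarilyInvariant (unitaryOrbit φ) := by
  intro V
  have hc : (PureState.act V ∘ fun U => PureState.act U φ)
      = (fun U => PureState.act U φ) ∘ fun U => V * U :=
    funext fun U => PureState.act_act V U _
  rw [unitaryOrbit, Measure.map_map (measurable_act V) (measurable_act_left _), hc,
    ← Measure.map_map (measurable_act_left _) (continuous_const_mul V).measurable,
    map_mul_left_eq_self]

theorem orthogonallyInvariant_orthogonalOrbit (φ : PureState ι) :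
    OrthogonallyInvariant (orthogonalOrbit φ) := by
  intro V
  have hc : (PureState.act (orthogonalToUnitary V) ∘
        fun O => PureState.act (orthogonalToUnitary O) φ)
      = (fun O => PureState.act (orthogonalToUnitary O) φ) ∘ fun O => V * O :=
    funext fun O => by
      simp only [Function.comp_apply, orthogonalToUnitary_mul, PureState.act_act]
  rw [orthogonalOrbit, Measure.map_map (measurable_act _) (measurable_act_orthogonal _), hc,
    ← Measure.map_map (measurable_act_orthogonal _) (continuous_const_mul V).measurable,
    map_mul_left_eq_self]

theorem integral_realOverlap_orthogonalOrbit (φ : PureState ι) :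
    ∫ ψ, realOverlap ψ ∂(orthogonalOrbit φ) = realOverlap φ := by
  rw [orthogonalOrbit, integral_map (measurable_act_orthogonal _).aemeasurable
    continuous_realOverlap.aestronglyMeasurable]
  simp [realOverlap_orthogonal]

end States

/-! ### Random product states and the two group averages. -/

theorem integral_realOverlap_stateMeasure (d : ℕ) [NeZero d] :
    ∫ ψ, realOverlap ψ ∂(stateMeasure d) = 2 / (d + 1) := by
  have h : UnitarilyInvariant (stateMeasure d) := stateMeasure_map_act d
  rw [h.integral_realOverlap, Fintype.card_fin]

theorem realOverlap_tensor {α β γ : Type*} [Fintype α] [Fintype β] [Fintype γ]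
    (a : PureState α) (b : PureState β) (c : PureState γ) :
    realOverlap (PureState.tensor a b c) = realOverlap a * (realOverlap b * realOverlap c) := by
  have h : ∑ i, (PureState.tensor a b c).coeff i ^ 2
      = (∑ i, a.coeff i ^ 2) * ((∑ i, b.coeff i ^ 2) * ∑ i, c.coeff i ^ 2) := by
    change ∑ i : α × β × γ, (a.coeff i.1 * (b.coeff i.2.1 * c.coeff i.2.2)) ^ 2 = _
    simp only [Fintype.sum_prod_type, mul_pow, ← Finset.mul_sum, ← Finset.sum_mul]
  rw [realOverlap, h, norm_mul, norm_mul, mul_pow, mul_pow]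
  rfl

section Main

variable {d₁ d₂ d₃ : ℕ} [NeZero d₁] [NeZero d₂] [NeZero d₃]

theorem integral_realOverlap_tensor :
    ∫ p : PureState (Fin d₁) × PureState (Fin d₂) × PureState (Fin d₃),
      realOverlap (PureState.tensor p.1 p.2.1 p.2.2)
        ∂((stateMeasure d₁).prod ((stateMeasure d₂).prod (stateMeasure d₃)))
      = 2 / (d₁ + 1) * (2 / (d₂ + 1) * (2 / (d₃ + 1))) := by
  simp only [realOverlap_tensor]
  rw [integral_prod_mul (fun a => realOverlap a)
      (fun q : PureState (Fin d₂) × PureState (Fin d₃) => realOverlap q.1 * realOverlap q.2),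
    integral_prod_mul (fun a => realOverlap a) (fun a => realOverlap a)]
  simp only [integral_realOverlap_stateMeasure]

/-- Averaging the entangling power over a compact group. -/
theorem integrable_and_integral_entanglingPower {G : Type*} [TopologicalSpace G] [CompactSpace G]
    [MeasurableSpace G] [BorelSpace G] (ν : Measure G) [IsProbabilityMeasure ν]
    {ρ : G → unitaryGroup (Fin d₁ × Fin d₂ × Fin d₃) ℂ} (hρ : Continuous ρ) :
    Integrable (fun g => entanglingPower (ρ g)) ν ∧
    ∫ g, entanglingPower (ρ g) ∂ν =
      ∫ p : PureState (Fin d₁) × PureState (Fin d₂) × PureState (Fin d₃),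
        (∫ ψ, oneTangle ψ ∂(ν.map fun g => PureState.act (ρ g)
          (PureState.tensor p.1 p.2.1 p.2.2)))
        ∂((stateMeasure d₁).prod ((stateMeasure d₂).prod (stateMeasure d₃))) := by
  have hc : Continuous fun x : G × (PureState (Fin d₁) × PureState (Fin d₂) × PureState (Fin d₃)) =>
      PureState.act (ρ x.1) (PureState.tensor x.2.1 x.2.2.1 x.2.2.2) :=
    PureState.continuous_act.comp ((hρ.comp continuous_fst).prodMk
      (PureState.continuous_tensor.comp continuous_snd))
  set f : G → PureState (Fin d₁) × PureState (Fin d₂) × PureState (Fin d₃) → ℝ :=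
    fun g p => oneTangle (PureState.act (ρ g) (PureState.tensor p.1 p.2.1 p.2.2)) with hf
  have hfc : Continuous (Function.uncurry f) := continuous_oneTangle.comp hc
  -- Joint continuity on a compact product provides the integrability that Fubini requires.
  have hi := hfc.integrable_of_compactSpace
    (ν.prod ((stateMeasure d₁).prod ((stateMeasure d₂).prod (stateMeasure d₃))))
  refine ⟨Integrable.integral_prod_left (f := Function.uncurry f) hi,
    (integral_integral_swap hi).trans ?_⟩
  refine integral_congr_ae (Filter.Eventually.of_forall fun p => ?_)
  exact (integral_map (hc.comp (Continuous.prodMk_left p)).measurable.aemeasurable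
    continuous_oneTangle.aestronglyMeasurable).symm

end Main

end EntanglingPower

end
open EntanglingPower in
theorem mainTheorem7 (d₁ d₂ d₃ : ℕ) [NeZero d₁] [NeZero d₂] [NeZero d₃] (A : ℝ)
    (hA : A = 3 - d₁ - d₂ - d₃ - d₁ * d₂ - d₁ * d₃ - d₂ * d₃ + 3 * (d₁ * d₂ * d₃)) :
    (Integrable (fun U : unitaryGroup (Fin d₁ × Fin d₂ × Fin d₃) ℂ => entanglingPower U)
        (haarProb (unitaryGroup (Fin d₁ × Fin d₂ × Fin d₃) ℂ)) ∧
      ∫ U : unitaryGroup (Fin d₁ × Fin d₂ × Fin d₃) ℂ, entanglingPower U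
          ∂(haarProb (unitaryGroup (Fin d₁ × Fin d₂ × Fin d₃) ℂ))
        = 2 * A / (3 * (d₁ * d₂ * d₃ + 1))) ∧
    (Integrable (fun O : orthogonalGroup (Fin d₁ × Fin d₂ × Fin d₃) ℝ =>
          entanglingPower (orthogonalToUnitary O))
        (haarProb (orthogonalGroup (Fin d₁ × Fin d₂ × Fin d₃) ℝ)) ∧
      (1 < d₁ * d₂ * d₃ →
        ∫ O : orthogonalGroup (Fin d₁ × Fin d₂ × Fin d₃) ℝ, entanglingPower (orthogonalToUnitary O)
            ∂(haarProb (orthogonalGroup (Fin d₁ × Fin d₂ × Fin d₃) ℝ))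
          = 2 * A * (d₁ * (d₁ + 1) * (d₂ * (d₂ + 1)) * (d₃ * (d₃ + 1)) - 8)
            / (3 * (d₁ * d₂ * d₃ - 1) * (d₁ * d₂ * d₃ + 2)
              * ((d₁ + 1) * (d₂ + 1) * (d₃ + 1))))) := by
  obtain ⟨hU, hU'⟩ := integrable_and_integral_entanglingPower (d₁ := d₁) (d₂ := d₂) (d₃ := d₃)
    (haarProb (unitaryGroup (Fin d₁ × Fin d₂ × Fin d₃) ℂ)) continuous_id
  obtain ⟨hO, hO'⟩ := integrable_and_integral_entanglingPower (d₁ := d₁) (d₂ := d₂) (d₃ := d₃)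
    (haarProb (orthogonalGroup (Fin d₁ × Fin d₂ × Fin d₃) ℝ)) continuous_orthogonalToUnitary
  have hcard : (Fintype.card (Fin d₁ × Fin d₂ × Fin d₃) : ℝ) = d₁ * d₂ * d₃ := by
    simp [mul_assoc]
  refine ⟨⟨hU, hU'.trans ?_⟩, hO, fun hD => hO'.trans ?_⟩
  -- The unitary mean does not depend on φ, so the average over product states is trivial.
  · have key (φ : PureState (Fin d₁ × Fin d₂ × Fin d₃)) :
        ∫ ψ, oneTangle ψ ∂(unitaryOrbit φ) = 2 * A / (3 * (d₁ * d₂ * d₃ + 1)) := by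
      obtain ⟨y, hy⟩ := (unitarilyInvariant_unitaryOrbit φ).exists_isotropicMoments
      rw [hy.integral_oneTangle hy.card_mul_of_left_eq_zero, hcard, hA]
      simp only [Fintype.card_fin]
      field_simp
      ring
    refine (integral_congr_ae (Filter.Eventually.of_forall fun p => key _)).trans ?_
    simp
  · have hD' : (1 : ℝ) < d₁ * d₂ * d₃ := by exact_mod_cast hD
    have hnt : Nontrivial (Fin d₁ × Fin d₂ × Fin d₃) := by
      rw [← Fintype.one_lt_card_iff_nontrivial]
      simpa [mul_assoc] using hD
    -- The orthogonal mean is affine in the overlap of φ, so only the mean overlap of product states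
    -- enters.
    have h1 : (d₁ * d₂ * d₃ - 1 : ℝ) ≠ 0 := (sub_pos.2 hD').ne'
    have key (φ : PureState (Fin d₁ × Fin d₂ × Fin d₃)) :
        ∫ ψ, oneTangle ψ ∂(orthogonalOrbit φ) = 2 * A / (3 * ((d₁ * d₂ * d₃ - 1) *
          (d₁ * d₂ * d₃ + 2))) * (d₁ * d₂ * d₃ - realOverlap φ) := by
      obtain ⟨x, y, hxy⟩ := (orthogonallyInvariant_orthogonalOrbit φ).exists_isotropicMoments
      rw [hxy.integral_oneTangle hxy.card_mul_eq, hcard, hA,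
        integral_realOverlap_orthogonalOrbit]
      simp only [Fintype.card_fin]
      field_simp
      ring
    refine (integral_congr_ae (Filter.Eventually.of_forall fun p => key _)).trans ?_
    have hint : Integrable (fun p : PureState (Fin d₁) × PureState (Fin d₂) × PureState (Fin d₃) =>
        realOverlap (PureState.tensor p.1 p.2.1 p.2.2))
        ((stateMeasure d₁).prod ((stateMeasure d₂).prod (stateMeasure d₃))) :=
      (continuous_realOverlap.comp PureState.continuous_tensor).integrable_of_compactSpace _
    -- D - 8/∏(dᵢ+1) = (∏dᵢ(dᵢ+1) - 8)/∏(dᵢ+1) is the source of the bracket in the formula.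
    rw [integral_const_mul, integral_sub (integrable_const _) hint, integral_realOverlap_tensor]
    simp only [integral_const, probReal_univ, one_smul]
    field_simp
    ring
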